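/- Let $V$ be a real vector space of finite dimension $n$ and let $\mathcal H$ be a finite set of linear hyperplanes (subspaces of codimension one) of $V$ with $\bigcap_{H\in\mathcal H}H=0$. A flat of $\mathcal H$ is an intersection $\bigcap_{H\in J}H$ with $J\subset\mathcal H$ (for $J=\emptyset$ this is $V$). The dual arrangement $\mathcal H^\vee$ is the finite set of hyperplanes $l^\perp=\{f\in V^*: f|_l=0\}$ of $V^*$, where $l$ runs over the one-dimensional flats of $\mathcal H$. Its faces are the classes of points of $V^*$ that have the same position (on the hyperplane, or strictly on one of its two sides) with respect to every hyperplane of $\mathcal H^\vee$. The dimension of a face is the dimension of its linear span, a chamber is a face of dimension $n$, and for faces $A^\vee,B^\vee$ we write $A^\vee\le B^\vee$ if $A^\vee\subset\overline{B^\vee}$. For a face $A^\vee$ define the big dual cone and the small dual cone by $$U(A^\vee)=\{x\in V: f(x)\ge 0\ \text{ for all } f\in A^\vee\},\qquad V(A^\vee)=\bigcap_{\substack{B^\vee\ge A^\vee\\ B^\vee\text{ a chamber}}}U(B^\vee).$$ For $Z\subset V$ let $\mathbf 1_Z:V\to\mathbb R$ be the characteristic function of $Z$. Then for every face $A^\vee$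 of $\mathcal H^\vee$ one has the following identities of functions on $V$, the sums being over the (finitely many) faces $B^\vee$ of $\mathcal H^\vee$ with $B^\vee\ge A^\vee$: $$\text{(a)}\qquad \mathbf 1_{U(A^\vee)}=\sum_{B^\vee\ge A^\vee}(-1)^{n-\dim(B^\vee)}\,\mathbf 1_{V(B^\vee)},$$ $$\text{(b)}\qquad \mathbf 1_{V(A^\vee)}=\sum_{B^\vee\ge A^\vee}(-1)^{n-\dim(B^\vee)}\,\mathbf 1_{U(B^\vee)}.$$ -/

import Mathlib

/-- A finite central arrangement of hyperplanes: a finite set of linear hyperplanes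
(linear subspaces of codimension one) in a real vector space. -/
structure HyperplaneArrangement (E : Type*) [AddCommGroup E] [Module ℝ E] where
  /-- the finite set of hyperplanes -/
  hyperplanes : Finset (Submodule ℝ E)
  codim_eq_one : ∀ H ∈ hyperplanes, Module.finrank ℝ (E ⧸ H) = 1

namespace HyperplaneArrangement

open Module

section Faces

variable {E : Type*} [AddCommGroup E] [Module ℝ E]

/-- The intersection of all the hyperplanes is `0`. -/
def IsEssential (𝓗 : HyperplaneArrangement E) : Prop :=
  ⨅ H ∈ 𝓗.hyperplanes, H = ⊥

/-- A flat is the intersection of some (possibly none, possibly all) of the hyperplanes. -/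
def IsFlat (𝓗 : HyperplaneArrangement E) (L : Submodule ℝ E) : Prop :=
  ∃ J : Finset (Submodule ℝ E), J ⊆ 𝓗.hyperplanes ∧ L = ⨅ H ∈ J, H

/-- `x` and `y` have the same position with respect to every hyperplane `H`: every linear
equation of `H` has the same sign (positive, zero or negative) at `x` and at `y`. -/
def SamePosition (𝓗 : HyperplaneArrangement E) (x y : E) : Prop :=
  ∀ H ∈ 𝓗.hyperplanes, ∀ φ : Dual ℝ E, LinearMap.ker φ = H →
    SignType.sign (φ x) = SignType.sign (φ y)

/-- The faces of an arrangement: the classes of points with the same position. -/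
def Face (𝓗 : HyperplaneArrangement E) : Type _ :=
  {F : Set E // ∃ x : E, F = {y | 𝓗.SamePosition x y}}

/-- The underlying set of points of a face. -/
def Face.carrier {𝓗 : HyperplaneArrangement E} (A : 𝓗.Face) : Set E := A.1

/-- The dimension of a face, that is, the dimension of its linear span. -/
noncomputable def Face.dim {𝓗 : HyperplaneArrangement E} (A : 𝓗.Face) : ℕ :=
  finrank ℝ (Submodule.span ℝ A.carrier)

/-- Chambers are the faces of full dimension. -/
def Face.IsChamber {𝓗 : HyperplaneArrangement E} (A : 𝓗.Face) : Prop :=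
  A.dim = finrank ℝ E

/-- The order on faces: `A ≤ B` when `A` is contained in the closure of `B`. -/
instance [TopologicalSpace E] (𝓗 : HyperplaneArrangement E) : LE 𝓗.Face :=
  ⟨fun A B => A.carrier ⊆ closure B.carrier⟩

theorem exists_equation (H : Submodule ℝ E) (h : finrank ℝ (E ⧸ H) = 1) :
    ∃ φ : Dual ℝ E, LinearMap.ker φ = H := by
  have : FiniteDimensional ℝ (E ⧸ H) := FiniteDimensional.of_finrank_eq_succ h
  let e : (E ⧸ H) ≃ₗ[ℝ] ℝ := LinearEquiv.ofFinrankEq _ _ (by simpa using h)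
  refine ⟨e.toLinearMap ∘ₗ H.mkQ, ?_⟩
  rw [LinearEquiv.ker_comp, Submodule.ker_mkQ]

theorem sign_eq_of_ker_eq {φ ψ : Dual ℝ E} (h : LinearMap.ker φ = LinearMap.ker ψ) {x y : E}
    (hs : SignType.sign (φ x) = SignType.sign (φ y)) :
    SignType.sign (ψ x) = SignType.sign (ψ y) := by
  obtain ⟨c, hc⟩ : ∃ c : ℝ, c • φ = ψ := by
    have := (mem_span_of_iInf_ker_le_ker (L := fun _ : Unit => φ) (K := ψ) (by simp [h]))
    simpa [Submodule.mem_span_singleton] using this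
  simp [← hc, sign_mul, hs]

/-- An arrangement has finitely many faces. -/
instance finite_face (𝓗 : HyperplaneArrangement E) : Finite 𝓗.Face := by
  choose φ hφ using fun H : 𝓗.hyperplanes => exists_equation H.1 (𝓗.codim_eq_one H.1 H.2)
  choose p hp using fun A : 𝓗.Face => A.2
  have key : ∀ x y : E, (∀ H, SignType.sign (φ H x) = SignType.sign (φ H y)) ↔
      𝓗.SamePosition x y := fun x y =>
    ⟨fun h H hH ψ hψ => sign_eq_of_ker_eq ((hφ ⟨H, hH⟩).trans hψ.symm) (h ⟨H, hH⟩),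
      fun h H => h H.1 H.2 _ (hφ H)⟩
  refine Finite.of_injective
    (fun (A : 𝓗.Face) (H : 𝓗.hyperplanes) => SignType.sign (φ H (p A))) fun A B hAB => ?_
  apply Subtype.ext
  rw [hp A, hp B]
  ext y
  have hs : ∀ H, SignType.sign (φ H (p A)) = SignType.sign (φ H (p B)) := fun H => congrFun hAB H
  change 𝓗.SamePosition (p A) y ↔ 𝓗.SamePosition (p B) y
  simp only [← key, hs]

noncomputable instance (𝓗 : HyperplaneArrangement E) : Fintype 𝓗.Face := Fintype.ofFinite _

end Faces

section Dual

variable {V : Type*} [NormedAddCommGroup V] [NormedSpace ℝ V]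

/-- The orthogonal of a subspace of `V` in the dual space of `V`. -/
def orthogonal (L : Submodule ℝ V) : Submodule ℝ (StrongDual ℝ V) where
  carrier := {f | ∀ x ∈ L, f x = 0}
  add_mem' hf hg x hx := by simp [hf x hx, hg x hx]
  zero_mem' := by simp
  smul_mem' c f hf x hx := by simp [hf x hx]

theorem finrank_quotient_orthogonal (L : Submodule ℝ V) (hL : finrank ℝ L = 1) :
    finrank ℝ (StrongDual ℝ V ⧸ orthogonal L) = 1 := by
  obtain ⟨v, hv, hspan⟩ := finrank_eq_one_iff'.mp hL
  have hv' : (v : V) ≠ 0 := by simpa using hv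
  let ev : StrongDual ℝ V →ₗ[ℝ] ℝ :=
    { toFun := fun f => f v, map_add' := fun _ _ => rfl, map_smul' := fun _ _ => rfl }
  have hker : LinearMap.ker ev = orthogonal L := by
    ext f
    refine ⟨fun hf x hx => ?_, fun hf => hf v v.2⟩
    obtain ⟨c, hc⟩ := hspan ⟨x, hx⟩
    have hx' : x = c • (v : V) := by simpa using (congrArg Subtype.val hc).symm
    have hf' : f v = 0 := hf
    simp [hx', hf']
  have hsurj : Function.Surjective ev := by
    obtain ⟨g, -, hg⟩ := exists_dual_vector ℝ (v : V) (by simpa using hv')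
    intro t
    refine ⟨(t / ‖(v : V)‖) • g, ?_⟩
    have : ‖(v : V)‖ ≠ 0 := by simpa using hv'
    simp [ev, hg, this]
  rw [← hker, (ev.quotKerEquivOfSurjective hsurj).finrank_eq, finrank_self]

open Classical in
/-- The dual arrangement, in the dual space: its hyperplanes are the orthogonals of the
one-dimensional flats. -/
noncomputable def dual (𝓗 : HyperplaneArrangement V) :
    HyperplaneArrangement (StrongDual ℝ V) where
  hyperplanes :=
    ((𝓗.hyperplanes.powerset.image fun J => (⨅ H ∈ J, H : Submodule ℝ V)).filter
      fun l : Submodule ℝ V => finrank ℝ l = 1).image orthogonal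
  codim_eq_one K hK := by
    obtain ⟨l, hl, rfl⟩ := Finset.mem_image.mp hK
    exact finrank_quotient_orthogonal l (Finset.mem_filter.mp hl).2

theorem mem_dual_hyperplanes (𝓗 : HyperplaneArrangement V)
    (K : Submodule ℝ (StrongDual ℝ V)) :
    K ∈ 𝓗.dual.hyperplanes ↔
      ∃ l : Submodule ℝ V, 𝓗.IsFlat l ∧ finrank ℝ l = 1 ∧ K = orthogonal l := by
  simp only [dual, IsFlat, Finset.mem_image, Finset.mem_filter, Finset.mem_powerset]
  constructor
  · rintro ⟨l, ⟨⟨J, hJ, rfl⟩, hl⟩, rfl⟩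
    exact ⟨_, ⟨J, hJ, rfl⟩, hl, rfl⟩
  · rintro ⟨l, ⟨J, hJ, rfl⟩, hl, rfl⟩
    exact ⟨_, ⟨⟨J, hJ, rfl⟩, hl⟩, rfl⟩

/-- The big dual cone of a face `A` of the dual arrangement. -/
def bigCone {𝓗 : HyperplaneArrangement V} (A : 𝓗.dual.Face) : Set V :=
  {x | ∀ f ∈ A.carrier, 0 ≤ f x}

/-- The small dual cone of a face `A` of the dual arrangement: the intersection of the big
dual cones of all chambers `B ≥ A`. -/
def smallCone {𝓗 : HyperplaneArrangement V} (A : 𝓗.dual.Face) : Set V :=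
  ⋂ (B : 𝓗.dual.Face) (_ : A ≤ B) (_ : B.IsChamber), bigCone B

end Dual

end HyperplaneArrangement

/-!
A relatively open convex set has Euler characteristic with compact supports `(-1) ^ d`, where `d` is
the dimension of its span, and this number is additive along the decomposition of the set by an
arrangement: cutting by one hyperplane either does nothing or replaces a `d`-cell by two `d`-cells
and a `(d - 1)`-cell.

For (b), fix `x ∈ V` and regard it as a functional on `V*`. The faces above `A` are those meeting
the open star of `A`, and those of them on which `x` takes a negative value are those meeting the
part of the star where `x < 0`. Both sets are open and convex, so the faces `B ≥ A` with `x ≥ 0` on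
`B` have the alternating sum `(-1) ^ n` if `x ≥ 0` on the star and `0` otherwise. As the chambers
are dense, `x ≥ 0` on the star of `A` if and only if `x` lies in the small dual cone of `A`.

For (a), invert (b): the faces between `A` and `C` make up a convex relatively open subset of the
span of `C` from which some open half-spaces have been removed. These have a common point in it,
found by moving from `A` slightly away from `C`, so the alternating sum vanishes unless `A = C`.
-/

open Module Filter Topology

section RelativelyOpen

variable {E : Type*} [AddCommGroup E] [Module ℝ E] [TopologicalSpace E] [ContinuousAdd E]
  [ContinuousSMul ℝ E] {O : Set E}

theorem tendsto_add_smul_nhdsGT_zero (p w : E) :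
    Tendsto (fun ε : ℝ => p + ε • w) (𝓝[>] 0) (𝓝 p) := by
  have hcont : Continuous fun ε : ℝ => p + ε • w := by fun_prop
  simpa using (hcont.tendsto 0).mono_left nhdsWithin_le_nhds

theorem eventually_add_smul_mem (hO : IsOpen O) {p : E} (hp : p ∈ O) (w : E) :
    ∀ᶠ ε in 𝓝[>] (0 : ℝ), p + ε • w ∈ O :=
  (tendsto_add_smul_nhdsGT_zero p w).eventually_mem (hO.mem_nhds hp)

theorem span_isOpen_inter (hO : IsOpen O) {W : Submodule ℝ E} (hne : (O ∩ W).Nonempty) :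
    Submodule.span ℝ (O ∩ W) = W := by
  refine le_antisymm (Submodule.span_le.2 Set.inter_subset_right) fun w hw => ?_
  obtain ⟨p, hpO, hpW⟩ := hne
  obtain ⟨ε, hε, hpos⟩ := ((eventually_add_smul_mem hO hpO w).and self_mem_nhdsWithin).exists
  have hp : p ∈ Submodule.span ℝ (O ∩ W) := Submodule.subset_span ⟨hpO, hpW⟩
  have hpw : p + ε • w ∈ Submodule.span ℝ (O ∩ W) :=
    Submodule.subset_span ⟨hε, W.add_mem hpW (W.smul_mem ε hw)⟩
  exact (Submodule.smul_mem_iff _ (ne_of_gt hpos)).1 ((Submodule.add_mem_iff_right _ hp).1 hpw)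

end RelativelyOpen

theorem finrank_inf_ker_add_one {K E : Type*} [Field K] [AddCommGroup E] [Module K E]
    {W : Submodule K E} [FiniteDimensional K W] {ψ : Dual K E} (h : ¬ W ≤ LinearMap.ker ψ) :
    finrank K (W ⊓ LinearMap.ker ψ : Submodule K E) + 1 = finrank K W := by
  have hne : ψ.domRestrict W ≠ 0 := fun h0 => h fun w hw => LinearMap.congr_fun h0 ⟨w, hw⟩
  rw [← Dual.finrank_ker_add_one_of_ne_zero hne, LinearMap.ker_domRestrict,
    ← Submodule.finrank_map_subtype_eq W, Submodule.map_comap_subtype]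

theorem convex_sign_eq {E : Type*} [AddCommGroup E] [Module ℝ E] (ψ : Dual ℝ E) (s : SignType) :
    Convex ℝ {y | SignType.sign (ψ y) = s} :=
  ((Set.ordConnected_singleton.preimage_mono SignType.sign.monotone).convex).linear_preimage ψ

section SignCells

variable {E : Type*} [AddCommGroup E] [Module ℝ E] {ι : Type*} {φ : ι → Dual ℝ E}
  {σ τ : ι → SignType} {y : E}

/-- The set of points at which the functionals `φ` have the signs prescribed by `σ`: a face of
the arrangement of the kernels of `φ`, or the empty set. -/
def signCell (φ : ι → Dual ℝ E) (σ : ι → SignType) : Set E :=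
  {y | ∀ i, SignType.sign (φ i y) = σ i}

/-- The open star of a nonempty sign cell, that is, the union of the sign cells whose closure
contains it: only the nonzero signs are prescribed. -/
def signStar (φ : ι → Dual ℝ E) (σ : ι → SignType) : Set E :=
  {y | ∀ i, σ i ≠ 0 → SignType.sign (φ i y) = σ i}

/-- The linear span of a nonempty sign cell, cut out by the functionals of prescribed sign `0`;
see `span_signCell`. -/
def signSpan (φ : ι → Dual ℝ E) (σ : ι → SignType) : Submodule ℝ E :=
  ⨅ (i) (_ : σ i = 0), LinearMap.ker (φ i)

theorem mem_signSpan : y ∈ signSpan φ σ ↔ ∀ i, σ i = 0 → φ i y = 0 := by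
  simp only [signSpan, Submodule.mem_iInf, LinearMap.mem_ker]

theorem signStar_inter_signSpan (φ : ι → Dual ℝ E) (σ : ι → SignType) :
    signStar φ σ ∩ signSpan φ σ = signCell φ σ := by
  ext y
  simp only [Set.mem_inter_iff, SetLike.mem_coe, mem_signSpan]
  refine ⟨fun h i => ?_, fun h => ⟨fun i _ => h i, fun i hi => ?_⟩⟩
  · by_cases hi : σ i = 0
    · rw [h.2 i hi, sign_zero, hi]
    · exact h.1 i hi
  · rw [← sign_eq_zero_iff, h i, hi]

theorem signStar_eq_iInter (φ : ι → Dual ℝ E) (σ : ι → SignType) :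
    signStar φ σ = ⋂ (i) (_ : σ i ≠ 0), {y | SignType.sign (φ i y) = σ i} := by
  ext y
  simp only [signStar, Set.mem_iInter, Set.mem_ofPred_eq]

theorem convex_signStar (φ : ι → Dual ℝ E) (σ : ι → SignType) : Convex ℝ (signStar φ σ) := by
  rw [signStar_eq_iInter]
  exact convex_iInter₂ fun i _ => convex_sign_eq _ _

/-- The union of the sign cells between `σ` and `τ` in the closure order. -/
def signInterval (φ : ι → Dual ℝ E) (σ τ : ι → SignType) : Set E :=
  signStar φ σ ∩ {y | ∀ i, SignType.sign (φ i y) ≠ 0 → τ i = SignType.sign (φ i y)}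

theorem signInterval_eq (φ : ι → Dual ℝ E) (hστ : ∀ i, σ i ≠ 0 → τ i = σ i) :
    signInterval φ σ τ =
      signStar φ σ ∩ signSpan φ τ ∩
        {y | ∀ i, σ i = 0 → τ i ≠ 0 → SignType.sign (φ i y) ≠ -τ i} := by
  have sign_cases : ∀ a b : SignType, (b ≠ 0 → a = b) ↔ (a = 0 → b = 0) ∧ (a ≠ 0 → b ≠ -a) := by
    decide
  ext y
  simp only [signInterval, Set.mem_inter_iff, SetLike.mem_coe, mem_signSpan,
    Set.mem_ofPred_eq, sign_cases, forall_and, sign_eq_zero_iff, and_assoc]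
  refine and_congr_right fun hy => and_congr_right fun _ => forall_congr' fun i => ?_
  by_cases hi : σ i = 0
  · simp only [hi, true_imp_iff]
  · have hne_neg : σ i ≠ -σ i := fun h => hi (SignType.self_eq_neg_iff.1 h)
    simp only [hy i hi, hστ i hi, hi, hne_neg, ne_eq, not_false_eq_true, implies_true]

variable [TopologicalSpace E] [IsTopologicalAddGroup E] [ContinuousSMul ℝ E] [T2Space E]
  [FiniteDimensional ℝ E]

theorem isOpen_sign_eq (ψ : Dual ℝ E) {s : SignType} (hs : s ≠ 0) :
    IsOpen {y | SignType.sign (ψ y) = s} := by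
  refine isOpen_iff_mem_nhds.2 fun y (hy : SignType.sign (ψ y) = s) => ?_
  have hψ : ContinuousAt (fun z => SignType.sign (ψ z)) y :=
    (continuousAt_sign_of_ne_zero (sign_ne_zero.1 (hy ▸ hs))).comp
      ψ.continuous_of_finiteDimensional.continuousAt
  exact hψ.preimage_mem_nhds ((isOpen_discrete {s}).mem_nhds hy)

variable [Finite ι]

theorem isOpen_signStar (φ : ι → Dual ℝ E) (σ : ι → SignType) : IsOpen (signStar φ σ) := by
  rw [signStar_eq_iInter]
  exact isOpen_iInter_of_finite fun i => isOpen_iInter_of_finite fun hi => isOpen_sign_eq _ hi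

theorem span_signCell (hne : (signCell φ σ).Nonempty) :
    Submodule.span ℝ (signCell φ σ) = signSpan φ σ := by
  rw [← signStar_inter_signSpan] at hne ⊢
  exact span_isOpen_inter (isOpen_signStar φ σ) hne

theorem span_signCell_inter {O : Set E} (hO : IsOpen O) (hne : (signCell φ σ ∩ O).Nonempty) :
    Submodule.span ℝ (signCell φ σ ∩ O) = Submodule.span ℝ (signCell φ σ) := by
  rw [span_signCell hne.left]
  rw [← signStar_inter_signSpan, Set.inter_right_comm] at hne ⊢
  exact span_isOpen_inter ((isOpen_signStar φ σ).inter hO) hne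

/-- The cell reached is the composition of `σ` and `τ` in the sense of oriented matroids. -/
theorem eventually_add_smul_mem_signCell {p w : E} (hp : p ∈ signCell φ σ)
    (hw : w ∈ signCell φ τ) : ∀ᶠ ε in 𝓝[>] (0 : ℝ),
      p + ε • w ∈ signCell φ fun i => if σ i = 0 then τ i else σ i := by
  refine eventually_all.2 fun i => ?_
  beta_reduce
  split_ifs with hi
  · have hpi : φ i p = 0 := sign_eq_zero_iff.1 ((hp i).trans hi)
    filter_upwards [self_mem_nhdsWithin] with ε hε
    rw [map_add, map_smul, hpi, zero_add, smul_eq_mul, sign_mul, sign_pos hε, one_mul, hw i]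
  · exact eventually_add_smul_mem (isOpen_sign_eq (φ i) hi) (hp i) w

end SignCells

section EulerCharacteristic

variable {E : Type*} [AddCommGroup E] [Module ℝ E]

theorem exists_mem_eq_zero_of_convex {S : Set E} (hS : Convex ℝ S) {ψ : Dual ℝ E} {p q : E}
    (hp : p ∈ S) (hq : q ∈ S) (hψp : ψ p ≤ 0) (hψq : 0 ≤ ψ q) : ∃ r ∈ S, ψ r = 0 :=
  (hS.linear_image ψ).ordConnected.out ⟨p, hp, rfl⟩ ⟨q, hq, rfl⟩ ⟨hψp, hψq⟩

theorem nonempty_inter_sign_eq_zero_iff [TopologicalSpace E] [ContinuousAdd E]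
    [ContinuousSMul ℝ E] {O : Set E} (hO : IsOpen O) (hc : Convex ℝ O) {W : Submodule ℝ E}
    {ψ : Dual ℝ E} (hW : ¬ W ≤ LinearMap.ker ψ) :
    (O ∩ W ∩ {y | SignType.sign (ψ y) = 0}).Nonempty ↔
      (O ∩ W ∩ {y | SignType.sign (ψ y) = -1}).Nonempty ∧
        (O ∩ W ∩ {y | SignType.sign (ψ y) = 1}).Nonempty := by
  constructor
  · rintro ⟨p, ⟨hpO, hpW⟩, hp⟩
    have hψp : ψ p = 0 := sign_eq_zero_iff.1 hp
    have move : ∀ w ∈ W, (O ∩ W ∩ {y | SignType.sign (ψ y) = SignType.sign (ψ w)}).Nonempty := by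
      intro w hw
      obtain ⟨ε, hε, hpos⟩ := ((eventually_add_smul_mem hO hpO w).and self_mem_nhdsWithin).exists
      refine ⟨p + ε • w, ⟨hε, W.add_mem hpW (W.smul_mem ε hw)⟩, ?_⟩
      simp [hψp, sign_mul, sign_pos hpos]
    obtain ⟨w, hw, hψw⟩ := SetLike.not_le_iff_exists.1 hW
    have hpos := move w hw
    have hneg := move (-w) (W.neg_mem hw)
    rw [map_neg, Left.sign_neg] at hneg
    rcases lt_or_gt_of_ne hψw with h | h
    · rw [sign_neg h] at hpos hneg
      exact ⟨hpos, hneg⟩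
    · rw [sign_pos h] at hpos hneg
      exact ⟨hneg, hpos⟩
  · rintro ⟨⟨p, hp, hψp⟩, q, hq, hψq⟩
    obtain ⟨r, hr, hψr⟩ := exists_mem_eq_zero_of_convex (hc.inter W.convex) hp hq
      (sign_eq_neg_one_iff.1 hψp).le (sign_eq_one_iff.1 hψq).le
    exact ⟨r, hr, sign_eq_zero_iff.2 hψr⟩

theorem nonempty_iff_sign_eq_neg_one_or_one [TopologicalSpace E] [ContinuousAdd E]
    [ContinuousSMul ℝ E] {O : Set E} (hO : IsOpen O) (hc : Convex ℝ O) {W : Submodule ℝ E}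
    {ψ : Dual ℝ E} (hW : ¬ W ≤ LinearMap.ker ψ) :
    (O ∩ W).Nonempty ↔ (O ∩ W ∩ {y | SignType.sign (ψ y) = -1}).Nonempty ∨
      (O ∩ W ∩ {y | SignType.sign (ψ y) = 1}).Nonempty := by
  refine ⟨fun ⟨y, hy⟩ => ?_, fun h => h.elim Set.Nonempty.left Set.Nonempty.left⟩
  rcases h : SignType.sign (ψ y) with _ | _ | _
  · exact .inl ((nonempty_inter_sign_eq_zero_iff hO hc hW).1 ⟨y, hy, h⟩).1
  · exact .inl ⟨y, hy, h⟩
  · exact .inr ⟨y, hy, h⟩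

open Classical in
/-- The Euler characteristic with compact supports of a set `C` that is empty or a convex
relatively open subset of a linear subspace, hence a cell of the dimension of its span. -/
noncomputable def cellEulerChar (C : Set E) : ℝ :=
  if C.Nonempty then (-1) ^ finrank ℝ (Submodule.span ℝ C) else 0

@[simp]
theorem cellEulerChar_empty : cellEulerChar (∅ : Set E) = 0 :=
  if_neg Set.not_nonempty_empty

/-- The Euler characteristic with compact supports of a set `S`, computed from the decomposition
of `S` into the pieces `signCell φ σ ∩ S`, each of which should be a cell. -/
noncomputable def eulerChar {ι : Type*} (φ : ι → Dual ℝ E) (S : Set E) : ℝ :=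
  ∑ᶠ σ : ι → SignType, cellEulerChar (signCell φ σ ∩ S)

section Decomposition

variable {ι κ : Type*}

theorem eulerChar_comp_equiv (e : κ ≃ ι) (φ : ι → Dual ℝ E) (S : Set E) :
    eulerChar (φ ∘ e) S = eulerChar φ S := by
  refine finsum_eq_of_bijective _ (e.arrowCongr (Equiv.refl SignType)).bijective fun σ => ?_
  have hcell : signCell φ (e.arrowCongr (Equiv.refl _) σ) = signCell (φ ∘ e) σ := by
    ext y
    simp [signCell, e.forall_congr_left]
  rw [hcell]

theorem eulerChar_of_isEmpty [IsEmpty ι] (φ : ι → Dual ℝ E) (S : Set E) :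
    eulerChar φ S = cellEulerChar S := by
  have hcell : ∀ σ, signCell φ σ = Set.univ := fun σ =>
    Set.eq_univ_of_forall fun y i => isEmptyElim i
  simp only [eulerChar, hcell, Set.univ_inter, finsum_unique]

theorem eulerChar_option [Finite ι] (φ : Option ι → Dual ℝ E) (S : Set E) :
    eulerChar φ S = ∑ s, eulerChar (φ ∘ some) (S ∩ {y | SignType.sign (φ none y) = s}) := by
  rw [eulerChar, ← finsum_comp_equiv Equiv.piOptionEquivProd.symm,
    finsum_curry _ (Set.toFinite _), finsum_eq_sum_of_fintype]
  refine Finset.sum_congr rfl fun s _ => finsum_congr fun σ => congrArg cellEulerChar ?_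
  ext y
  simp only [signCell, Set.mem_inter_iff, Set.mem_ofPred_eq, Option.forall]
  exact ⟨fun h => ⟨h.1.2, h.2, h.1.1⟩, fun h => ⟨⟨h.2.2, h.1⟩, h.2.1⟩⟩

theorem signCell_subset_or_disjoint_sign_eq (φ : ι → Dual ℝ E) (i : ι) (s : SignType)
    (σ : ι → SignType) : signCell φ σ ⊆ {y | SignType.sign (φ i y) = s} ∨
      Disjoint (signCell φ σ) {y | SignType.sign (φ i y) = s} := by
  by_cases h : σ i = s
  · exact .inl fun y hy => (hy i).trans h
  · exact .inr (Set.disjoint_left.2 fun y hy hys => h ((hy i).symm.trans hys))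

theorem eulerChar_inter_add_diff [Finite ι] {φ : ι → Dual ℝ E} {T : Set E}
    (hT : ∀ σ, signCell φ σ ⊆ T ∨ Disjoint (signCell φ σ) T) (S : Set E) :
    eulerChar φ (S ∩ T) + eulerChar φ (S \ T) = eulerChar φ S := by
  simp only [eulerChar]
  rw [← finsum_add_distrib (Set.toFinite _) (Set.toFinite _)]
  refine finsum_congr fun σ => ?_
  rcases hT σ with h | h
  · have hinter : signCell φ σ ∩ (S ∩ T) = signCell φ σ ∩ S := by
      rw [← Set.inter_assoc, Set.inter_eq_left.2 (Set.inter_subset_left.trans h)]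
    have hdiff : signCell φ σ ∩ (S \ T) = ∅ := by
      rw [← Set.inter_sdiff_assoc, Set.sdiff_eq_empty.2 (Set.inter_subset_left.trans h)]
    rw [hinter, hdiff, cellEulerChar_empty, add_zero]
  · have hdisj : Disjoint (signCell φ σ ∩ S) T := h.mono_left Set.inter_subset_left
    have hinter : signCell φ σ ∩ (S ∩ T) = ∅ := by
      rw [← Set.inter_assoc, hdisj.inter_eq]
    have hdiff : signCell φ σ ∩ (S \ T) = signCell φ σ ∩ S := by
      rw [← Set.inter_sdiff_assoc, hdisj.sdiff_eq_left]
    rw [hinter, hdiff, cellEulerChar_empty, zero_add]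

end Decomposition

theorem inter_sign_eq_zero (O : Set E) (W : Submodule ℝ E) (ψ : Dual ℝ E) :
    O ∩ W ∩ {y | SignType.sign (ψ y) = 0} = O ∩ ↑(W ⊓ LinearMap.ker ψ) := by
  ext y
  simp [and_assoc]

variable [TopologicalSpace E] [IsTopologicalAddGroup E] [ContinuousSMul ℝ E]

open Classical in
theorem cellEulerChar_isOpen_inter {O : Set E} (hO : IsOpen O) (W : Submodule ℝ E) :
    cellEulerChar (O ∩ W) = if (O ∩ W).Nonempty then (-1) ^ finrank ℝ W else 0 := by
  rw [cellEulerChar]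
  split_ifs with hne
  · rw [span_isOpen_inter hO hne]
  · rfl

variable [T2Space E] [FiniteDimensional ℝ E]

theorem sum_cellEulerChar_inter_sign_eq {O : Set E} (hO : IsOpen O) (hc : Convex ℝ O)
    (W : Submodule ℝ E) (ψ : Dual ℝ E) :
    ∑ s, cellEulerChar (O ∩ W ∩ {y | SignType.sign (ψ y) = s}) = cellEulerChar (O ∩ W) := by
  have huniv : (Finset.univ : Finset SignType) = {0, -1, 1} := by decide
  rw [huniv, Finset.sum_insert (by decide), Finset.sum_insert (by decide), Finset.sum_singleton]
  by_cases hW : W ≤ LinearMap.ker ψ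
  · have hsign : ∀ y ∈ O ∩ (W : Set E), SignType.sign (ψ y) = 0 := fun y hy =>
      sign_eq_zero_iff.2 (hW hy.2)
    have hzero : O ∩ W ∩ {y | SignType.sign (ψ y) = 0} = O ∩ W := Set.inter_eq_left.2 hsign
    have hempty : ∀ s : SignType, s ≠ 0 → O ∩ W ∩ {y | SignType.sign (ψ y) = s} = ∅ :=
      fun s hs => Set.eq_empty_of_forall_notMem fun y hy =>
        hs (hy.2.symm.trans (hsign y hy.1))
    rw [hzero, hempty (-1) (by decide), hempty 1 (by decide)]
    simp
  · classical
    have hcell_zero := cellEulerChar_isOpen_inter hO (W ⊓ LinearMap.ker ψ)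
    have hcell : ∀ s : SignType, s ≠ 0 →
        cellEulerChar (O ∩ W ∩ {y | SignType.sign (ψ y) = s}) =
          if (O ∩ W ∩ {y | SignType.sign (ψ y) = s}).Nonempty then (-1) ^ finrank ℝ W else 0 := by
      intro s hs
      rw [Set.inter_right_comm]
      exact cellEulerChar_isOpen_inter (hO.inter (isOpen_sign_eq ψ hs)) W
    rw [hcell (-1) (by decide), hcell 1 (by decide), cellEulerChar_isOpen_inter hO W]
    rw [← inter_sign_eq_zero, nonempty_inter_sign_eq_zero_iff hO hc hW] at hcell_zero
    have hpow : (-1 : ℝ) ^ finrank ℝ W = -(-1) ^ finrank ℝ ↥(W ⊓ LinearMap.ker ψ) := by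
      rw [← finrank_inf_ker_add_one hW, pow_succ, mul_neg_one]
    rw [hcell_zero, nonempty_iff_sign_eq_neg_one_or_one hO hc hW, hpow]
    by_cases hneg : (O ∩ W ∩ {y | SignType.sign (ψ y) = -1}).Nonempty <;>
      by_cases hpos : (O ∩ W ∩ {y | SignType.sign (ψ y) = 1}).Nonempty <;>
      simp [hneg, hpos]

theorem eulerChar_isOpen_inter {ι : Type*} [Finite ι] (φ : ι → Dual ℝ E)
    {O : Set E} (hO : IsOpen O) (hc : Convex ℝ O) (W : Submodule ℝ E) :
    eulerChar φ (O ∩ W) = cellEulerChar (O ∩ W) := by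
  induction ι using Finite.induction_empty_option generalizing O W with
  | of_equiv e ih =>
    rw [← eulerChar_comp_equiv e]
    exact ih (φ ∘ e) hO hc W
  | h_empty => exact eulerChar_of_isEmpty φ _
  | h_option ih =>
    have hpiece : ∀ s, eulerChar (φ ∘ some) (O ∩ W ∩ {y | SignType.sign (φ none y) = s}) =
        cellEulerChar (O ∩ W ∩ {y | SignType.sign (φ none y) = s}) := by
      intro s
      by_cases hs : s = 0
      · rw [hs, inter_sign_eq_zero]
        exact ih _ hO hc _
      · rw [Set.inter_right_comm]
        exact ih _ (hO.inter (isOpen_sign_eq _ hs)) (hc.inter (convex_sign_eq _ s)) W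
    rw [eulerChar_option, Finset.sum_congr rfl fun s _ => hpiece s,
      sum_cellEulerChar_inter_sign_eq hO hc W (φ none)]

open Classical in
/-- Removing one half-space at a time, the part removed last is empty in the Euler characteristic
because all the half-spaces have a common point in `O ∩ W`. -/
theorem eulerChar_inter_sign_ne {ι : Type*} [Finite ι] (φ : ι → Dual ℝ E) {O : Set E}
    (hO : IsOpen O) (hc : Convex ℝ O) (W : Submodule ℝ E) {s : ι → SignType} (J : Finset ι)
    (hs : ∀ i ∈ J, s i ≠ 0)
    (hne : (O ∩ W ∩ {y | ∀ i ∈ J, SignType.sign (φ i y) = s i}).Nonempty) :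
    eulerChar φ (O ∩ W ∩ {y | ∀ i ∈ J, SignType.sign (φ i y) ≠ s i}) =
      if J = ∅ then (-1) ^ finrank ℝ W else 0 := by
  induction J using Finset.induction_on generalizing O with
  | empty =>
    simp only [Finset.notMem_empty, false_imp_iff, implies_true, Set.ofPred_true,
      Set.inter_univ] at hne ⊢
    rw [eulerChar_isOpen_inter φ hO hc W, cellEulerChar_isOpen_inter hO W, if_pos hne,
      if_pos trivial]
  | insert i J _ ih =>
    obtain ⟨hsi, hsJ⟩ := (Finset.forall_mem_insert _ _ _).1 hs
    obtain ⟨p, hp, hpJ⟩ := hne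
    obtain ⟨hpi, hpJ⟩ := (Finset.forall_mem_insert _ _ _).1 hpJ
    have hwhole := ih hO hc hsJ ⟨p, hp, hpJ⟩
    have hpart := ih (hO.inter (isOpen_sign_eq (φ i) hsi)) (hc.inter (convex_sign_eq (φ i) (s i)))
      hsJ ⟨p, ⟨⟨hp.1, hpi⟩, hp.2⟩, hpJ⟩
    have hadd := eulerChar_inter_add_diff (signCell_subset_or_disjoint_sign_eq φ i (s i))
      (O ∩ W ∩ {y | ∀ j ∈ J, SignType.sign (φ j y) ≠ s j})
    rw [Set.inter_right_comm, Set.inter_right_comm O, hpart, hwhole, add_eq_left] at hadd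
    have hset : O ∩ W ∩ {y | ∀ j ∈ insert i J, SignType.sign (φ j y) ≠ s j} =
        (O ∩ W ∩ {y | ∀ j ∈ J, SignType.sign (φ j y) ≠ s j}) \
          {y | SignType.sign (φ i y) = s i} := by
      ext y
      simp only [Set.mem_inter_iff, Set.mem_sdiff, Set.mem_ofPred_eq, Finset.forall_mem_insert]
      tauto
    rw [hset, hadd, if_neg (Finset.insert_ne_empty i J)]

/-- A point of the cell `σ` pushed slightly away from the cell `τ`. -/
theorem exists_mem_signStar_inter_signSpan_sign_eq_neg {ι : Type*} [Finite ι]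
    {φ : ι → Dual ℝ E} {σ τ : ι → SignType} (hστ : ∀ i, σ i ≠ 0 → τ i = σ i)
    (hσ : (signCell φ σ).Nonempty) (hτ : (signCell φ τ).Nonempty) :
    ∃ y ∈ signStar φ σ ∩ signSpan φ τ, ∀ i, σ i = 0 → SignType.sign (φ i y) = -τ i := by
  obtain ⟨a, ha⟩ := hσ
  obtain ⟨c, hc⟩ := hτ
  have hneg : -c ∈ signCell φ (-τ) := fun i => by
    rw [map_neg, Left.sign_neg, hc i, Pi.neg_apply]
  obtain ⟨ε, hε⟩ := (eventually_add_smul_mem_signCell ha hneg).exists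
  have hsign : ∀ i, SignType.sign (φ i (a + ε • -c)) = if σ i = 0 then -τ i else σ i := hε
  refine ⟨a + ε • -c, ⟨fun i hi => ?_, mem_signSpan.2 fun i hi => ?_⟩, fun i hi => ?_⟩
  · rw [hsign i, if_neg hi]
  · have hσi : σ i = 0 := by
      by_contra h
      exact h ((hστ i h).symm.trans hi)
    rw [← sign_eq_zero_iff, hsign i, if_pos hσi, hi, neg_zero]
  · rw [hsign i, if_pos hi]

open Classical in
theorem eulerChar_signInterval {ι : Type*} [Finite ι] {φ : ι → Dual ℝ E} {σ τ : ι → SignType}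
    (hστ : ∀ i, σ i ≠ 0 → τ i = σ i) (hσ : (signCell φ σ).Nonempty)
    (hτ : (signCell φ τ).Nonempty) :
    eulerChar φ (signInterval φ σ τ) = if σ = τ then (-1) ^ finrank ℝ (signSpan φ τ) else 0 := by
  have := Fintype.ofFinite ι
  set J : Finset ι := {i | σ i = 0 ∧ τ i ≠ 0}
  have hJ : J = ∅ ↔ σ = τ := by
    rw [Finset.filter_eq_empty_iff, funext_iff]
    refine ⟨fun h i => ?_, fun h i _ hi => hi.2 ((h i).symm.trans hi.1)⟩
    by_cases hi : σ i = 0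
    · exact hi.trans (not_not.1 fun hτi => h (Finset.mem_univ i) ⟨hi, hτi⟩).symm
    · exact (hστ i hi).symm
  obtain ⟨y, hy, hyneg⟩ := exists_mem_signStar_inter_signSpan_sign_eq_neg hστ hσ hτ
  have hchar := eulerChar_inter_sign_ne φ (isOpen_signStar φ σ) (convex_signStar φ σ)
    (signSpan φ τ) (s := fun i => -τ i) J
    (fun i hi h => (Finset.mem_filter.1 hi).2.2 (SignType.neg_eq_zero_iff.1 h))
    ⟨y, hy, fun i hi => hyneg i (Finset.mem_filter.1 hi).2.1⟩
  have hset : {y | ∀ i, σ i = 0 → τ i ≠ 0 → SignType.sign (φ i y) ≠ -τ i} =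
      {y | ∀ i ∈ J, SignType.sign (φ i y) ≠ -τ i} := by
    simp [J]
  rw [signInterval_eq φ hστ, hset, hchar]
  by_cases h : σ = τ
  · rw [if_pos h, if_pos (hJ.2 h)]
  · rw [if_neg h, if_neg (hJ.not.2 h)]

end EulerCharacteristic

namespace HyperplaneArrangement

section Equations

variable {E : Type*} [AddCommGroup E] [Module ℝ E] {𝓐 : HyperplaneArrangement E}

/-- A chosen linear equation of each hyperplane of the arrangement. -/
noncomputable def equation (𝓐 : HyperplaneArrangement E) (H : 𝓐.hyperplanes) : Dual ℝ E :=
  (exists_equation H.1 (𝓐.codim_eq_one H.1 H.2)).choose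

theorem ker_equation (H : 𝓐.hyperplanes) : LinearMap.ker (𝓐.equation H) = H :=
  (exists_equation H.1 (𝓐.codim_eq_one H.1 H.2)).choose_spec

theorem exists_equation_apply_ne_zero (H : 𝓐.hyperplanes) : ∃ x, 𝓐.equation H x ≠ 0 := by
  by_contra! h
  have hH : (H : Submodule ℝ E) = ⊤ := by
    rw [← ker_equation H, LinearMap.ker_eq_top]
    exact LinearMap.ext h
  have hcodim := 𝓐.codim_eq_one H.1 H.2
  rw [hH, finrank_zero_of_subsingleton] at hcodim
  exact zero_ne_one hcodim

theorem samePosition_iff {x y : E} : 𝓐.SamePosition x y ↔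
    ∀ H, SignType.sign (𝓐.equation H x) = SignType.sign (𝓐.equation H y) :=
  ⟨fun h H => h H.1 H.2 _ (ker_equation H),
    fun h H hH _ hψ => sign_eq_of_ker_eq ((ker_equation ⟨H, hH⟩).trans hψ.symm) (h ⟨H, hH⟩)⟩

/-- The covector of a face: the signs that the chosen equations take on it. -/
noncomputable def Face.signs (A : 𝓐.Face) (H : 𝓐.hyperplanes) : SignType :=
  SignType.sign (𝓐.equation H A.2.choose)

/-- The face containing a given point. -/
def faceAt (𝓐 : HyperplaneArrangement E) (y : E) : 𝓐.Face :=
  ⟨{z | 𝓐.SamePosition y z}, y, rfl⟩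

theorem mem_faceAt (y : E) : y ∈ (𝓐.faceAt y).carrier :=
  samePosition_iff.2 fun _ => rfl

theorem Face.carrier_eq (A : 𝓐.Face) : A.carrier = signCell 𝓐.equation A.signs := by
  ext y
  rw [Face.carrier, A.2.choose_spec]
  exact samePosition_iff.trans (forall_congr' fun H => eq_comm)

theorem Face.carrier_nonempty (A : 𝓐.Face) : A.carrier.Nonempty := by
  obtain ⟨x, hx⟩ := A.2
  exact ⟨x, hx.ge (samePosition_iff.2 fun _ => rfl)⟩

theorem Face.dim_le [FiniteDimensional ℝ E] (A : 𝓐.Face) : A.dim ≤ finrank ℝ E :=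
  Submodule.finrank_le _

theorem Face.neg_one_pow_codim [FiniteDimensional ℝ E] (A : 𝓐.Face) :
    (-1 : ℝ) ^ (finrank ℝ E - A.dim) = (-1) ^ finrank ℝ E * (-1) ^ A.dim := by
  rw [← pow_add]
  exact neg_one_pow_congr (by rw [Nat.even_sub A.dim_le, Nat.even_add])

theorem Face.le_trans [TopologicalSpace E] {A B C : 𝓐.Face} (hAB : A ≤ B) (hBC : B ≤ C) : A ≤ C :=
  hAB.trans (closure_minimal hBC isClosed_closure)

theorem Face.signCell_nonempty (A : 𝓐.Face) : (signCell 𝓐.equation A.signs).Nonempty :=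
  A.carrier_eq ▸ A.carrier_nonempty

theorem signs_faceAt {σ : 𝓐.hyperplanes → SignType} {y : E} (hy : y ∈ signCell 𝓐.equation σ) :
    (𝓐.faceAt y).signs = σ := by
  have hmem := mem_faceAt (𝓐 := 𝓐) y
  rw [Face.carrier_eq] at hmem
  exact funext fun H => (hmem H).symm.trans (hy H)

theorem signs_injective : Function.Injective (Face.signs : 𝓐.Face → 𝓐.hyperplanes → SignType) :=
  fun A B h => Subtype.ext (by
    change A.carrier = B.carrier
    rw [A.carrier_eq, h, B.carrier_eq])

open Classical in
theorem eulerChar_equation_eq_sum_faces {S : Set E} (hS : ∀ A : 𝓐.Face, (A.carrier ∩ S).Nonempty →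
      Submodule.span ℝ (A.carrier ∩ S) = Submodule.span ℝ A.carrier) :
    eulerChar 𝓐.equation S = ∑ A : 𝓐.Face with (A.carrier ∩ S).Nonempty, (-1) ^ A.dim := by
  rw [Finset.sum_filter, eulerChar, finsum_eq_sum_of_fintype]
  refine (Fintype.sum_of_injective _ signs_injective _ _ (fun σ hσ => ?_)
    fun A => ?_).symm
  · refine if_neg ?_
    rintro ⟨y, hy, -⟩
    exact hσ ⟨𝓐.faceAt y, signs_faceAt hy⟩
  · rw [← A.carrier_eq, cellEulerChar]
    split_ifs with h
    · rw [hS A h, Face.dim]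
    · rfl

end Equations

section Order

variable {E : Type*} [AddCommGroup E] [Module ℝ E] [TopologicalSpace E]
  [IsTopologicalAddGroup E] [ContinuousSMul ℝ E] [T2Space E] [FiniteDimensional ℝ E]
  {𝓐 : HyperplaneArrangement E}

theorem Face.dim_eq (A : 𝓐.Face) : A.dim = finrank ℝ (signSpan 𝓐.equation A.signs) := by
  rw [Face.dim, A.carrier_eq, span_signCell A.signCell_nonempty]

theorem span_face_inter {O : Set E} (hO : IsOpen O) {A : 𝓐.Face} (h : (A.carrier ∩ O).Nonempty) :
    Submodule.span ℝ (A.carrier ∩ O) = Submodule.span ℝ A.carrier := by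
  rw [A.carrier_eq] at h ⊢
  exact span_signCell_inter hO h

open Classical in
theorem sum_faces_meeting_isOpen {O : Set E} (hO : IsOpen O) (hc : Convex ℝ O) :
    ∑ A : 𝓐.Face with (A.carrier ∩ O).Nonempty, (-1 : ℝ) ^ A.dim =
      if O.Nonempty then (-1) ^ finrank ℝ E else 0 := by
  rw [← eulerChar_equation_eq_sum_faces fun A => span_face_inter hO]
  have h := eulerChar_isOpen_inter 𝓐.equation hO hc ⊤
  rw [cellEulerChar_isOpen_inter hO] at h
  simpa using h

/-- The open star of a face: the union of the faces above it, by `Face.le_iff_inter_star`. -/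
def Face.star (A : 𝓐.Face) : Set E :=
  signStar 𝓐.equation A.signs

theorem Face.le_iff {A B : 𝓐.Face} : A ≤ B ↔ ∀ H, A.signs H ≠ 0 → B.signs H = A.signs H := by
  constructor
  · intro h H hH
    obtain ⟨p, hp⟩ := A.carrier_nonempty
    have hpB := h hp
    rw [A.carrier_eq] at hp
    rw [B.carrier_eq] at hpB
    obtain ⟨q, hqA, hqB⟩ := mem_closure_iff.1 hpB _ (isOpen_sign_eq (𝓐.equation H) hH) (hp H)
    exact (hqB H).symm.trans hqA
  · intro h p hp
    obtain ⟨q, hq⟩ := B.carrier_nonempty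
    rw [A.carrier_eq] at hp
    rw [B.carrier_eq] at hq ⊢
    have hcomp : (fun H => if A.signs H = 0 then B.signs H else A.signs H) = B.signs := by
      funext H
      split_ifs with hH
      · rfl
      · exact (h H hH).symm
    have hnear := eventually_add_smul_mem_signCell hp hq
    rw [hcomp] at hnear
    exact mem_closure_of_tendsto (tendsto_add_smul_nhdsGT_zero p q) hnear

theorem Face.le_iff_mem_star {A B : 𝓐.Face} {y : E} (hy : y ∈ B.carrier) :
    A ≤ B ↔ y ∈ A.star := by
  rw [B.carrier_eq] at hy
  rw [Face.le_iff]
  exact forall₂_congr fun H _ => by rw [hy H]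

theorem Face.le_iff_inter_star {A B : 𝓐.Face} : A ≤ B ↔ (B.carrier ∩ A.star).Nonempty := by
  obtain ⟨y, hy⟩ := B.carrier_nonempty
  exact ⟨fun h => ⟨y, hy, (le_iff_mem_star hy).1 h⟩, fun ⟨_, hz, hzA⟩ => (le_iff_mem_star hz).2 hzA⟩

theorem exists_isChamber_inter_nonempty {O : Set E} (hO : IsOpen O) (hne : O.Nonempty) :
    ∃ C : 𝓐.Face, C.IsChamber ∧ (C.carrier ∩ O).Nonempty := by
  obtain ⟨p, hp⟩ := hne
  obtain ⟨g, hg⟩ :=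
    Dual.exists_forall_ne_zero_of_forall_exists 𝓐.equation exists_equation_apply_ne_zero
  have hpA : p ∈ signCell 𝓐.equation fun H => SignType.sign (𝓐.equation H p) := fun _ => rfl
  have hgA : g ∈ signCell 𝓐.equation fun H => SignType.sign (𝓐.equation H g) := fun _ => rfl
  obtain ⟨ε, hε, hεO⟩ :=
    ((eventually_add_smul_mem_signCell hpA hgA).and (eventually_add_smul_mem hO hp g)).exists
  refine ⟨𝓐.faceAt (p + ε • g), ?_, _, mem_faceAt _, hεO⟩
  have hspan : signSpan 𝓐.equation (𝓐.faceAt (p + ε • g)).signs = ⊤ := by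
    rw [signs_faceAt hε]
    refine eq_top_iff.2 fun z _ => mem_signSpan.2 fun H hH => absurd hH ?_
    split_ifs with h0
    · exact sign_ne_zero.2 (hg H)
    · exact h0
  rw [Face.IsChamber, Face.dim_eq, hspan, finrank_top]

theorem forall_isChamber_nonneg_iff {A : 𝓐.Face} {ξ : Dual ℝ E} :
    (∀ B : 𝓐.Face, A ≤ B → B.IsChamber → ∀ y ∈ B.carrier, 0 ≤ ξ y) ↔ ∀ y ∈ A.star, 0 ≤ ξ y := by
  refine ⟨fun h y hy => ?_, fun h B hAB _ y hy => h y ((Face.le_iff_mem_star hy).1 hAB)⟩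
  by_contra! hneg
  have hO : IsOpen (A.star ∩ {y | SignType.sign (ξ y) = -1}) :=
    (isOpen_signStar _ _).inter (isOpen_sign_eq ξ (by decide))
  obtain ⟨B, hB, z, hzB, hzA, hz⟩ :=
    exists_isChamber_inter_nonempty (𝓐 := 𝓐) hO ⟨y, hy, sign_neg hneg⟩
  exact (sign_eq_neg_one_iff.1 hz).not_ge (h B ((Face.le_iff_mem_star hzB).2 hzA) hB z hzB)

theorem Face.inter_star_neg_nonempty_iff {A B : 𝓐.Face} {ξ : Dual ℝ E} :
    (B.carrier ∩ (A.star ∩ {y | SignType.sign (ξ y) = -1})).Nonempty ↔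
      A ≤ B ∧ ¬ ∀ y ∈ B.carrier, 0 ≤ ξ y := by
  push Not
  constructor
  · rintro ⟨y, hyB, hyA, hy⟩
    exact ⟨(Face.le_iff_mem_star hyB).2 hyA, y, hyB, sign_eq_neg_one_iff.1 hy⟩
  · rintro ⟨hAB, y, hyB, hy⟩
    exact ⟨y, hyB, (Face.le_iff_mem_star hyB).1 hAB, sign_neg hy⟩

open Classical in
/-- The faces above `A`, and those among them that meet `ξ < 0`, are the faces meeting a convex
open set: the star of `A`, respectively its part where `ξ < 0`. -/
theorem sum_nonneg_faces (A : 𝓐.Face) (ξ : Dual ℝ E) :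
    ∑ B : 𝓐.Face with A ≤ B ∧ ∀ y ∈ B.carrier, 0 ≤ ξ y, (-1 : ℝ) ^ B.dim =
      if ∀ y ∈ A.star, 0 ≤ ξ y then (-1) ^ finrank ℝ E else 0 := by
  have hopen : IsOpen A.star := isOpen_signStar _ _
  have hconvex : Convex ℝ A.star := convex_signStar _ _
  have hstar_ne : A.star.Nonempty := by
    obtain ⟨p, hp⟩ := A.carrier_nonempty
    exact ⟨p, (Face.le_iff_mem_star hp).1 subset_closure⟩
  have hneg_ne : (A.star ∩ {y | SignType.sign (ξ y) = -1}).Nonempty ↔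
      ¬ ∀ y ∈ A.star, 0 ≤ ξ y := by
    push Not
    exact exists_congr fun y => and_congr_right fun _ => sign_eq_neg_one_iff
  have hstar := sum_faces_meeting_isOpen (𝓐 := 𝓐) hopen hconvex
  have hneg := sum_faces_meeting_isOpen (𝓐 := 𝓐)
    (hopen.inter (isOpen_sign_eq ξ (s := -1) (by decide))) (hconvex.inter (convex_sign_eq ξ (-1)))
  simp only [← Face.le_iff_inter_star, if_pos hstar_ne] at hstar
  simp only [Face.inter_star_neg_nonempty_iff, hneg_ne, ← Finset.filter_filter] at hneg
  rw [← Finset.filter_filter]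
  have hsplit := Finset.sum_filter_add_sum_filter_not ({B : 𝓐.Face | A ≤ B} : Finset 𝓐.Face)
    (fun B => ∀ y ∈ B.carrier, 0 ≤ ξ y) fun B => (-1 : ℝ) ^ B.dim
  rw [hneg, hstar] at hsplit
  split_ifs at hsplit ⊢ <;> simpa using hsplit

open Classical in
theorem sum_faces_between {A C : 𝓐.Face} (hAC : A ≤ C) :
    ∑ B : 𝓐.Face with A ≤ B ∧ B ≤ C, (-1 : ℝ) ^ B.dim = if A = C then (-1) ^ C.dim else 0 := by
  have hmem : ∀ {B : 𝓐.Face} {y : E}, y ∈ B.carrier →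
      (y ∈ signInterval 𝓐.equation A.signs C.signs ↔ A ≤ B ∧ B ≤ C) := by
    intro B y hy
    refine and_congr (Face.le_iff_mem_star hy).symm ?_
    rw [B.carrier_eq] at hy
    rw [Face.le_iff]
    exact forall_congr' fun H => by rw [hy H]
  have hmeet : ∀ B : 𝓐.Face,
      (B.carrier ∩ signInterval 𝓐.equation A.signs C.signs).Nonempty ↔ A ≤ B ∧ B ≤ C := by
    intro B
    obtain ⟨y, hy⟩ := B.carrier_nonempty
    exact ⟨fun ⟨z, hzB, hz⟩ => (hmem hzB).1 hz, fun h => ⟨y, hy, (hmem hy).2 h⟩⟩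
  have hspan : ∀ B : 𝓐.Face,
      (B.carrier ∩ signInterval 𝓐.equation A.signs C.signs).Nonempty →
        Submodule.span ℝ (B.carrier ∩ signInterval 𝓐.equation A.signs C.signs) =
          Submodule.span ℝ B.carrier := by
    intro B h
    rw [Set.inter_eq_left.2 fun y hy => (hmem hy).2 ((hmeet B).1 h)]
  have hchar := eulerChar_signInterval (Face.le_iff.1 hAC) A.signCell_nonempty C.signCell_nonempty
  rw [eulerChar_equation_eq_sum_faces hspan] at hchar
  simpa only [hmeet, signs_injective.eq_iff, ← C.dim_eq] using hchar

open Classical in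
theorem face_moebius_inversion {M : Type*} [AddCommGroup M] [Module ℝ M] {u v : 𝓐.Face → M}
    (h : ∀ B, v B = ∑ C : 𝓐.Face with B ≤ C, (-1 : ℝ) ^ (finrank ℝ E - C.dim) • u C)
    (A : 𝓐.Face) :
    u A = ∑ B : 𝓐.Face with A ≤ B, (-1 : ℝ) ^ (finrank ℝ E - B.dim) • v B := by
  have hcoeff : ∀ C : 𝓐.Face, A ≤ C →
      ∑ B : 𝓐.Face with A ≤ B ∧ B ≤ C,
          (-1 : ℝ) ^ (finrank ℝ E - B.dim) * (-1) ^ (finrank ℝ E - C.dim) =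
        if A = C then 1 else 0 := by
    intro C hAC
    simp only [Face.neg_one_pow_codim]
    rw [← Finset.sum_mul, ← Finset.mul_sum, sum_faces_between hAC, mul_mul_mul_comm,
      ← pow_add, Even.neg_one_pow ⟨_, rfl⟩, one_mul, ite_mul, zero_mul, ← pow_add,
      Even.neg_one_pow ⟨_, rfl⟩]
  simp only [h, Finset.smul_sum, smul_smul]
  rw [Finset.sum_comm' (t' := {C : 𝓐.Face | A ≤ C})
    (s' := fun C => {B : 𝓐.Face | A ≤ B ∧ B ≤ C}) fun B C => ?_]
  · simp only [← Finset.sum_smul]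
    rw [Finset.sum_congr rfl fun C hC => by rw [hcoeff C (Finset.mem_filter.1 hC).2]]
    have hA : A ≤ A := subset_closure
    simp [hA]
  · simp only [Finset.mem_filter, Finset.mem_univ, true_and]
    exact ⟨fun hBC => ⟨hBC, Face.le_trans hBC.1 hBC.2⟩, fun hBC => hBC.1⟩

end Order

section DualCones

variable {E F : Type*} [AddCommGroup E] [Module ℝ E] [TopologicalSpace E]
  [IsTopologicalAddGroup E] [ContinuousSMul ℝ E] [T2Space E] [FiniteDimensional ℝ E]
  [AddCommGroup F] [Module ℝ F] {𝓐 : HyperplaneArrangement E}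

/-- The small dual cone of a face `A` under a bilinear pairing `p`: the intersection of the dual
cones of the chambers above `A`. -/
def Face.smallDual (p : E →ₗ[ℝ] F →ₗ[ℝ] ℝ) (A : 𝓐.Face) : Set F :=
  ⋂ (B : 𝓐.Face) (_ : A ≤ B) (_ : B.IsChamber), (PointedCone.dual p B.carrier : Set F)

theorem Face.mem_smallDual_iff {p : E →ₗ[ℝ] F →ₗ[ℝ] ℝ} {A : 𝓐.Face} {x : F} :
    x ∈ A.smallDual p ↔ ∀ y ∈ A.star, 0 ≤ p y x := by
  refine Iff.trans ?_ (forall_isChamber_nonneg_iff (ξ := p.flip x))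
  simp only [Face.smallDual, Set.mem_iInter]
  rfl

open Classical in
theorem indicator_smallDual_eq_sum (p : E →ₗ[ℝ] F →ₗ[ℝ] ℝ) (A : 𝓐.Face) :
    (A.smallDual p).indicator (1 : F → ℝ) =
      ∑ B : 𝓐.Face with A ≤ B, (-1 : ℝ) ^ (finrank ℝ E - B.dim) •
        (PointedCone.dual p B.carrier : Set F).indicator (1 : F → ℝ) := by
  funext x
  have hsum := sum_nonneg_faces A (p.flip x)
  have hmem : ∀ B : 𝓐.Face, x ∈ (PointedCone.dual p B.carrier : Set F) ↔
      ∀ y ∈ B.carrier, 0 ≤ p.flip x y := fun B => Iff.rfl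
  simp only [Finset.sum_apply, Pi.smul_apply, Set.indicator_apply, hmem, Face.mem_smallDual_iff,
    Face.neg_one_pow_codim, Pi.one_apply, smul_eq_mul, mul_ite, mul_one, mul_zero]
  rw [← Finset.sum_filter, Finset.filter_filter, ← Finset.mul_sum, hsum, mul_ite, ← pow_add,
    Even.neg_one_pow ⟨_, rfl⟩, mul_zero]
  rfl

end DualCones

end HyperplaneArrangement

open Classical in
theorem corollary4p8_general {E F : Type*} [AddCommGroup E] [Module ℝ E] [TopologicalSpace E]
    [IsTopologicalAddGroup E] [ContinuousSMul ℝ E] [T2Space E] [FiniteDimensional ℝ E]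
    [AddCommGroup F] [Module ℝ F] (p : E →ₗ[ℝ] F →ₗ[ℝ] ℝ) {𝓐 : HyperplaneArrangement E}
    (A : 𝓐.Face) :
    ((PointedCone.dual p A.carrier : Set F).indicator (1 : F → ℝ) =
      ∑ B : 𝓐.Face with A ≤ B, (-1 : ℝ) ^ (finrank ℝ E - B.dim) •
        (B.smallDual p).indicator (1 : F → ℝ)) ∧
    ((A.smallDual p).indicator (1 : F → ℝ) =
      ∑ B : 𝓐.Face with A ≤ B, (-1 : ℝ) ^ (finrank ℝ E - B.dim) •
        (PointedCone.dual p B.carrier : Set F).indicator (1 : F → ℝ)) :=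
  have hsmall := HyperplaneArrangement.indicator_smallDual_eq_sum p (𝓐 := 𝓐)
  ⟨HyperplaneArrangement.face_moebius_inversion hsmall A, hsmall A⟩

theorem finrank_strongDual {𝕜 : Type*} [NontriviallyNormedField 𝕜] [CompleteSpace 𝕜] (V : Type*)
    [AddCommGroup V] [Module 𝕜 V] [TopologicalSpace V] [IsTopologicalAddGroup V]
    [ContinuousSMul 𝕜 V] [T2Space V] [FiniteDimensional 𝕜 V] :
    finrank 𝕜 (StrongDual 𝕜 V) = finrank 𝕜 V :=
  (LinearMap.toContinuousLinearMap (𝕜 := 𝕜) (E := V) (F' := 𝕜)).finrank_eq.symm.trans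
    Subspace.dual_finrank_eq

open Classical in
theorem corollary4p8 {V : Type*} [NormedAddCommGroup V] [NormedSpace ℝ V]
    [FiniteDimensional ℝ V] (𝓗 : HyperplaneArrangement V) (h𝓗 : 𝓗.IsEssential)
    (A : 𝓗.dual.Face) :
    ((HyperplaneArrangement.bigCone A).indicator (1 : V → ℝ) =
      ∑ B : 𝓗.dual.Face with A ≤ B, (-1 : ℝ) ^ (Module.finrank ℝ V - B.dim) •
        (HyperplaneArrangement.smallCone B).indicator (1 : V → ℝ)) ∧
    ((HyperplaneArrangement.smallCone A).indicator (1 : V → ℝ) =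
      ∑ B : 𝓗.dual.Face with A ≤ B, (-1 : ℝ) ^ (Module.finrank ℝ V - B.dim) •
        (HyperplaneArrangement.bigCone B).indicator (1 : V → ℝ)) := by
  rw [← finrank_strongDual (𝕜 := ℝ) V]
  exact corollary4p8_general (topDualPairing ℝ V) A
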